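/- **Setting.** Intersection types are $\sigma ::= \mathtt a \mid \sigma\to\sigma \mid \sigma\cap\sigma$, where $\mathtt a$ ranges over the atoms $\{\mathtt a_i \mid i\in\mathbb N\}$ for the theories CD and CDV, and over $\{\mathtt a_i \mid i\in\mathbb N\}\cup\{\omega\}$ for CDS and BCD. For each theory $\mathcal T$, $\leq_{\mathcal T}$ is the least relation satisfying reflexivity, transitivity, $\sigma\cap\tau\leq\sigma$, $\sigma\cap\tau\leq\tau$, and ($\rho\leq\sigma$, $\rho\leq\tau$ $\Rightarrow$ $\rho\leq\sigma\cap\tau$), together with: nothing more for CD; $(\omega_{top})$ $\sigma\leq\omega$ for CDS; for CDV the rules $(\to)$ ($\sigma_2\leq\sigma_1$, $\tau_1\leq\tau_2$ $\Rightarrow$ $\sigma_1\to\tau_1\leq\sigma_2\to\tau_2$) and $(\to\cap)$ $(\sigma\to\tau)\cap(\sigma\to\rho)\leq\sigma\to(\tau\cap\rho)$; for BCD the rules $(\to)$, $(\to\cap)$, $(\omega_{top})$ and $(\omega_\to)$ $\omega\leq\sigma\to\omega$. A basis $B$ assigns at most one type to each variable. The type assignment system $\lambda_\cap^{\mathcal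 T}$ derives judgments $B\vdash_\cap^{\mathcal T} M:\sigma$ for pure $\lambda$-terms $M$ (taken up to renaming of bound variables) by the rules: $B\vdash x:\sigma$ if $x{:}\sigma\in B$; if $B,x{:}\sigma\vdash M:\tau$ then $B\vdash\lambda x.M:\sigma\to\tau$; if $B\vdash M:\sigma\to\tau$ and $B\vdash N:\sigma$ then $B\vdash M\,N:\tau$; if $B\vdash M:\sigma$ and $B\vdash M:\tau$ then $B\vdash M:\sigma\cap\tau$; if $B\vdash M:\sigma\cap\tau$ then $B\vdash M:\sigma$ and $B\vdash M:\tau$; $B\vdash M:\omega$ for every $M$, if $\omega$ is an atom of $\mathcal T$; if $B\vdash M:\sigma$ and $\sigma\leq_{\mathcal T}\tau$ then $B\vdash M:\tau$. $\Delta$-terms are $\Delta ::= u_\Delta \mid x \mid \lambda x{:}\sigma.\Delta \mid \Delta\,\Delta \mid \langle\Delta,\Delta\rangle \mid pr_1\Delta \mid pr_2\Delta \mid \Delta^\sigma$ (the index of $u_\Delta$ need not be typable). The essence $\wr\Delta\wr$ is the pure $\lambda$-term given by $\wr x\wr = x$, $\wr\lambda x{:}\sigma.\Delta\wr=\lambda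 x.\wr\Delta\wr$, $\wr\Delta_1\,\Delta_2\wr=\wr\Delta_1\wr\,\wr\Delta_2\wr$, $\wr\langle\Delta_1,\Delta_2\rangle\wr=\wr\Delta_1\wr$, and $\wr u_\Delta\wr=\wr pr_i\Delta\wr=\wr\Delta^\sigma\wr=\wr\Delta\wr$. For $\mathcal R\in\{\equiv,=_\beta,=_{\beta\eta}\}$ (syntactic equality up to renaming of bound variables, $\beta$-equality, $\beta\eta$-equality), the typed system $\Delta^{\mathcal T}_{\mathcal R}$ derives judgments $B\vdash^{\mathcal T}_{\mathcal R}\Delta:\sigma$ by the rules: $B\vdash u_\Delta:\omega$ for every $\Delta$, if $\omega$ is an atom of $\mathcal T$; $B\vdash x:\sigma$ if $x{:}\sigma\in B$; if $B,x{:}\sigma\vdash\Delta:\tau$ then $B\vdash\lambda x{:}\sigma.\Delta:\sigma\to\tau$; if $B\vdash\Delta_1:\sigma\to\tau$ and $B\vdash\Delta_2:\sigma$ then $B\vdash\Delta_1\,\Delta_2:\tau$; if $B\vdash\Delta_1:\sigma$, $B\vdash\Delta_2:\tau$ and $\wr\Delta_1\wr\mathrel{\mathcal R}\wr\Delta_2\wr$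 then $B\vdash\langle\Delta_1,\Delta_2\rangle:\sigma\cap\tau$; if $B\vdash\Delta:\sigma\cap\tau$ then $B\vdash pr_1\Delta:\sigma$ and $B\vdash pr_2\Delta:\tau$; if $B\vdash\Delta:\sigma$ and $\sigma\leq_{\mathcal T}\tau$ then $B\vdash\Delta^\tau:\tau$. $\Delta^{\mathcal T}_{\mathcal R}$ is *sound* if $B\vdash^{\mathcal T}_{\mathcal R}\Delta:\sigma$ always implies $B\vdash^{\mathcal T}_\cap\wr\Delta\wr:\sigma$; it is *complete* if $B\vdash^{\mathcal T}_\cap M:\sigma$ always implies that there is a $\Delta$ with $\wr\Delta\wr\equiv M$ and $B\vdash^{\mathcal T}_{\mathcal R}\Delta:\sigma$; it is *isomorphic* to $\lambda^{\mathcal T}_\cap$ if it is sound and complete. **Theorem (Soundness, completeness and isomorphism).** 1. The six systems $\Delta^{CD}_\equiv$, $\Delta^{CDV}_\equiv$, $\Delta^{CDS}_\equiv$, $\Delta^{BCD}_\equiv$, $\Delta^{CDS}_{=_\beta}$, $\Delta^{BCD}_{=_\beta}$ are sound and complete, that is, isomorphic to the corresponding type assignment systems. 2. The four systems $\Delta^{CD}_{=_\beta}$,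 $\Delta^{CDV}_{=_\beta}$, $\Delta^{CDV}_{=_{\beta\eta}}$, $\Delta^{BCD}_{=_{\beta\eta}}$ are complete but not sound. 3. Explicit counterexamples to soundness are the following. (a) Let $\mathcal T\in\{CD,CDV\}$, let $\sigma,\tau,\rho$ be types, and put $\alpha=\sigma\to\tau\to\rho$, $\beta=(\sigma\to\tau)\to\sigma\to\rho$, $$\Delta=(\lambda x{:}\alpha\to\beta\to\alpha.\lambda y{:}\alpha\to\beta.\lambda z{:}\alpha.\,x\,z\,(y\,z))\,(\lambda x{:}\alpha.\lambda y{:}\beta.\,x)\,(\lambda x{:}\alpha.\lambda y{:}\sigma\to\tau.\lambda z{:}\sigma.\,x\,z\,(y\,z)).$$ Then $\vdash^{\mathcal T}_{=_\beta}pr_2\langle\Delta,\lambda x{:}\sigma.x\rangle:\sigma\to\sigma$, and the essence of this term is $\mathsf S\,\mathsf K\,\mathsf S$ with $\mathsf S=\lambda x.\lambda y.\lambda z.\,x\,z\,(y\,z)$ and $\mathsf K=\lambda x.\lambda y.\,x$; but $\not\vdash^{\mathcal T}_\cap\mathsf S\,\mathsf K\,\mathsf S:\sigma\to\sigma$ if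 $\sigma$ is an atom. (b) For all CDV-types $\sigma,\tau,\rho$ and $B=\{x{:}(\sigma\to\tau)\cap\rho\}$: $B\vdash^{CDV}_{=_{\beta\eta}}pr_2\langle\lambda y{:}\sigma.(pr_1x)\,y,\;pr_2x\rangle:\rho$, and the essence of this term is $\lambda y.x\,y$; but $B\not\vdash^{CDV}_\cap\lambda y.x\,y:\rho$ if $\rho$ is an atom. (c) For every BCD-type $\sigma$: $x{:}\sigma\vdash^{BCD}_{=_{\beta\eta}}pr_2\langle\lambda y{:}\omega.x^{\omega\to\omega}\,y,\;x\rangle:\sigma$, and the essence of this term is $\lambda y.x\,y$; but $x{:}\sigma\not\vdash^{BCD}_\cap\lambda y.x\,y:\sigma$ if $\sigma$ is an atom different from $\omega$. -/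

import Mathlib

namespace DeltaCalculus

/-! Intersection types and type theories. -/

/-- The names of the four intersection type theories. -/
inductive TypeTheory where
  | CD | CDV | CDS | BCD

/-- The theories whose set of atoms contains the universal type `ω`. -/
def TypeTheory.HasOmega (T : TypeTheory) : Prop := T = .CDS ∨ T = .BCD

/-- The theories with the schemes `(→)` and `(→∩)`. -/
def TypeTheory.HasArrow (T : TypeTheory) : Prop := T = .CDV ∨ T = .BCD

/-- Type atoms: the set `{aᵢ | i ∈ ℕ}` for `CD` and `CDV`, and `{aᵢ | i ∈ ℕ} ∪ {ω}` for `CDS` and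
`BCD` (the constructor `omega` needs a proof that the theory has `ω`). -/
inductive Atom (T : TypeTheory) where
  | a (i : ℕ)
  | omega (h : T.HasOmega)

/-- Intersection types over the atoms of the theory `T`. -/
inductive Ty (T : TypeTheory) where
  | atom (a : Atom T)
  | arrow (σ τ : Ty T)
  | inter (σ τ : Ty T)

/-- The universal type `ω`, available when `ω` is an atom of `T`. -/
def Ty.omega {T : TypeTheory} (h : T.HasOmega) : Ty T := .atom (.omega h)

/-- The subtype relation `σ ≤_T τ`: the least relation closed under the minimal type theory and the
additional schemes of `T`. These are: none for `CD`; `(ω_top)` for `CDS`; `(→)`, `(→∩)` for `CDV`;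
`(→)`, `(→∩)`, `(ω_top)`, `(ω_→)` for `BCD`. -/
inductive Le (T : TypeTheory) : Ty T → Ty T → Prop where
  | refl (σ : Ty T) : Le T σ σ
  | incl₁ (σ τ : Ty T) : Le T (.inter σ τ) σ
  | incl₂ (σ τ : Ty T) : Le T (.inter σ τ) τ
  | glb {ρ σ τ : Ty T} : Le T ρ σ → Le T ρ τ → Le T ρ (.inter σ τ)
  | trans {σ τ ρ : Ty T} : Le T σ τ → Le T τ ρ → Le T σ ρ
  | omegaTop (h : T.HasOmega) (σ : Ty T) : Le T σ (.omega h)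
  | omegaArrow (hB : T = .BCD) (h : T.HasOmega) (σ : Ty T) :
      Le T (.omega h) (.arrow σ (.omega h))
  | arrowInter (h : T.HasArrow) (σ τ ρ : Ty T) :
      Le T (.inter (.arrow σ τ) (.arrow σ ρ)) (.arrow σ (.inter τ ρ))
  | arrow (h : T.HasArrow) {σ₁ σ₂ τ₁ τ₂ : Ty T} :
      Le T σ₂ σ₁ → Le T τ₁ τ₂ → Le T (.arrow σ₁ τ₁) (.arrow σ₂ τ₂)

/-! Pure lambda-terms up to renaming of bound variables, in de Bruijn notation: below `k` binders,
the index `k + n` denotes the `n`-th free variable. -/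

/-- Pure lambda-terms. -/
inductive Term where
  | var (n : ℕ)
  | lam (M : Term)
  | app (M N : Term)

namespace Term

/-- The renaming that acts as `r` below one additional binder. -/
def liftRen (r : ℕ → ℕ) : ℕ → ℕ
  | 0 => 0
  | n + 1 => r n + 1

/-- Renaming of free variables. -/
def rename : (ℕ → ℕ) → Term → Term
  | r, var n => var (r n)
  | r, lam M => lam (rename (liftRen r) M)
  | r, app M N => app (rename r M) (rename r N)

/-- The substitution that acts as `s` below one additional binder. -/
def liftSubst (s : ℕ → Term) : ℕ → Term
  | 0 => var 0
  | n + 1 => rename Nat.succ (s n)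

/-- Simultaneous capture-avoiding substitution. -/
def subst : (ℕ → Term) → Term → Term
  | s, var n => s n
  | s, lam M => lam (subst (liftSubst s) M)
  | s, app M N => app (subst s M) (subst s N)

/-- The substitution that replaces the variable `0` by `N` and lowers all others by one. -/
def single (N : Term) : ℕ → Term
  | 0 => N
  | n + 1 => var n

/-- `M[x := N]`, where `x` is the variable `0` of `M` (and is removed). -/
def inst (M N : Term) : Term := subst (single N) M

/-- One-step beta-reduction in an arbitrary context. -/
inductive Beta : Term → Term → Prop where
  | redex (M N : Term) : Beta (app (lam M) N) (inst M N)
  | lam {M M' : Term} : Beta M M' → Beta (lam M) (lam M')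
  | appL {M M' : Term} (N : Term) : Beta M M' → Beta (app M N) (app M' N)
  | appR (M : Term) {N N' : Term} : Beta N N' → Beta (app M N) (app M N')

/-- One-step eta-reduction `λx. M x ⟶ M` (with `x` not free in `M`) in an arbitrary context. -/
inductive Eta : Term → Term → Prop where
  | redex (M : Term) : Eta (lam (app (rename Nat.succ M) (var 0))) M
  | lam {M M' : Term} : Eta M M' → Eta (lam M) (lam M')
  | appL {M M' : Term} (N : Term) : Eta M M' → Eta (app M N) (app M' N)
  | appR (M : Term) {N N' : Term} : Eta N N' → Eta (app M N) (app M N')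

/-- Beta-equality. -/
def BetaEq : Term → Term → Prop := Relation.EqvGen Beta

/-- Beta-eta-equality. -/
def BetaEtaEq : Term → Term → Prop := Relation.EqvGen fun M N => Beta M N ∨ Eta M N

end Term

/-- The names of the three equivalence relations on pure lambda-terms. -/
inductive TermRel where
  | syn | beta | betaEta

/-- The equivalence relations `≡` (equality up to renaming of bound variables), `=_β`, `=_βη`. -/
def TermRel.Holds : TermRel → Term → Term → Prop
  | .syn => fun M N => M = N
  | .beta => Term.BetaEq
  | .betaEta => Term.BetaEtaEq

/-! Bases. -/

/-- A basis assigns at most one type to each free variable. -/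
abbrev Basis (T : TypeTheory) := ℕ → Option (Ty T)

/-- The empty basis. -/
def Basis.empty {T : TypeTheory} : Basis T := fun _ => none

/-- `B, x : σ` for a fresh variable `x`, which gets the index `0`. -/
def Basis.cons {T : TypeTheory} (σ : Ty T) (B : Basis T) : Basis T
  | 0 => some σ
  | n + 1 => B n

/-! Type assignment systems in the style of Curry. -/

/-- The judgment `B ⊢ M : σ` of the intersection type assignment system for the theory `T`. -/
inductive Assigns (T : TypeTheory) : Basis T → Term → Ty T → Prop where
  | ax {B : Basis T} {n : ℕ} {σ : Ty T} : B n = some σ → Assigns T B (.var n) σ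
  | arrowI {B : Basis T} {M : Term} {σ τ : Ty T} :
      Assigns T (B.cons σ) M τ → Assigns T B (.lam M) (.arrow σ τ)
  | arrowE {B : Basis T} {M N : Term} {σ τ : Ty T} :
      Assigns T B M (.arrow σ τ) → Assigns T B N σ → Assigns T B (.app M N) τ
  | interI {B : Basis T} {M : Term} {σ τ : Ty T} :
      Assigns T B M σ → Assigns T B M τ → Assigns T B M (.inter σ τ)
  | interE₁ {B : Basis T} {M : Term} {σ τ : Ty T} :
      Assigns T B M (.inter σ τ) → Assigns T B M σ
  | interE₂ {B : Basis T} {M : Term} {σ τ : Ty T} :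
      Assigns T B M (.inter σ τ) → Assigns T B M τ
  | top {B : Basis T} (h : T.HasOmega) (M : Term) : Assigns T B M (.omega h)
  | sub {B : Basis T} {M : Term} {σ τ : Ty T} :
      Assigns T B M σ → Le T σ τ → Assigns T B M τ

/-! The Delta-calculus: typed systems in the style of Church. -/

/-- Delta-terms (de Bruijn notation), not necessarily typable. -/
inductive DTerm (T : TypeTheory) where
  /-- The constant `u_Δ` indexed by a Delta-term. -/
  | u (Δ : DTerm T)
  | var (n : ℕ)
  | lam (σ : Ty T) (Δ : DTerm T)
  | app (Δ₁ Δ₂ : DTerm T)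
  /-- The strong pair `⟨Δ₁, Δ₂⟩`. -/
  | pair (Δ₁ Δ₂ : DTerm T)
  | pr₁ (Δ : DTerm T)
  | pr₂ (Δ : DTerm T)
  /-- The explicit coercion of `Δ` to the type `σ`. -/
  | coe (Δ : DTerm T) (σ : Ty T)

/-- The essence of a Delta-term, a pure lambda-term. -/
def DTerm.essence {T : TypeTheory} : DTerm T → Term
  | .u Δ => Δ.essence
  | .var n => .var n
  | .lam _ Δ => .lam Δ.essence
  | .app Δ₁ Δ₂ => .app Δ₁.essence Δ₂.essence
  | .pair Δ₁ _ => Δ₁.essence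
  | .pr₁ Δ => Δ.essence
  | .pr₂ Δ => Δ.essence
  | .coe Δ _ => Δ.essence

/-- The judgment `B ⊢ Δ : σ` of the intersection typed system for the theory `T` and the
relation `R`. -/
inductive Typed (T : TypeTheory) (R : TermRel) : Basis T → DTerm T → Ty T → Prop where
  | top {B : Basis T} (h : T.HasOmega) (Δ : DTerm T) : Typed T R B (.u Δ) (.omega h)
  | ax {B : Basis T} {n : ℕ} {σ : Ty T} : B n = some σ → Typed T R B (.var n) σ
  | arrowI {B : Basis T} {Δ : DTerm T} {σ τ : Ty T} :
      Typed T R (B.cons σ) Δ τ → Typed T R B (.lam σ Δ) (.arrow σ τ)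
  | arrowE {B : Basis T} {Δ₁ Δ₂ : DTerm T} {σ τ : Ty T} :
      Typed T R B Δ₁ (.arrow σ τ) → Typed T R B Δ₂ σ → Typed T R B (.app Δ₁ Δ₂) τ
  | interI {B : Basis T} {Δ₁ Δ₂ : DTerm T} {σ τ : Ty T} :
      Typed T R B Δ₁ σ → Typed T R B Δ₂ τ → R.Holds Δ₁.essence Δ₂.essence →
      Typed T R B (.pair Δ₁ Δ₂) (.inter σ τ)
  | interE₁ {B : Basis T} {Δ : DTerm T} {σ τ : Ty T} :
      Typed T R B Δ (.inter σ τ) → Typed T R B (.pr₁ Δ) σ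
  | interE₂ {B : Basis T} {Δ : DTerm T} {σ τ : Ty T} :
      Typed T R B Δ (.inter σ τ) → Typed T R B (.pr₂ Δ) τ
  | sub {B : Basis T} {Δ : DTerm T} {σ τ : Ty T} :
      Typed T R B Δ σ → Le T σ τ → Typed T R B (.coe Δ τ) τ

/-! Relations between the two kinds of systems. -/

/-- Soundness of the typed system with respect to the type assignment system. -/
def Sound (T : TypeTheory) (R : TermRel) : Prop :=
  ∀ (B : Basis T) (Δ : DTerm T) (σ : Ty T), Typed T R B Δ σ → Assigns T B Δ.essence σ

/-- Completeness of the typed system with respect to the type assignment system. -/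
def Complete (T : TypeTheory) (R : TermRel) : Prop :=
  ∀ (B : Basis T) (M : Term) (σ : Ty T), Assigns T B M σ →
    ∃ Δ : DTerm T, M = Δ.essence ∧ Typed T R B Δ σ

/-- Isomorphism of the typed system and the type assignment system. -/
def Isomorphic (T : TypeTheory) (R : TermRel) : Prop := Complete T R ∧ Sound T R

/-! The terms of the counterexamples. -/

/-- `S = λx.λy.λz. x z (y z)`. -/
def Term.S : Term :=
  .lam (.lam (.lam (.app (.app (.var 2) (.var 0)) (.app (.var 1) (.var 0)))))

/-- `K = λx.λy. x`. -/
def Term.K : Term := .lam (.lam (.var 1))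

/-- `λx:σ.λy:τ.λz:ρ. x z (y z)`. -/
def DTerm.S {T : TypeTheory} (σ τ ρ : Ty T) : DTerm T :=
  .lam σ (.lam τ (.lam ρ (.app (.app (.var 2) (.var 0)) (.app (.var 1) (.var 0)))))

/-- `λx:σ.λy:τ. x`. -/
def DTerm.K {T : TypeTheory} (σ τ : Ty T) : DTerm T := .lam σ (.lam τ (.var 1))

/-- A simply typed version of `S K S`, of type `(σ → τ → ρ) → (σ → τ → ρ)`: with
`α = σ → τ → ρ` and `β = (σ → τ) → σ → ρ`, the term
`(λx:α → β → α. λy:α → β. λz:α. x z (y z)) (λx:α. λy:β. x) (λx:α. λy:σ → τ. λz:σ. x z (y z))`. -/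
def DTerm.SKS {T : TypeTheory} (σ τ ρ : Ty T) : DTerm T :=
  let α : Ty T := .arrow σ (.arrow τ ρ)
  let β : Ty T := .arrow (.arrow σ τ) (.arrow σ ρ)
  .app (.app (.S (.arrow α (.arrow β α)) (.arrow α β) α) (.K α β)) (.S α (.arrow σ τ) σ)

/-- `pr₂ ⟨SKS, λx:σ. x⟩`. -/
def DTerm.cexBeta {T : TypeTheory} (σ τ ρ : Ty T) : DTerm T :=
  .pr₂ (.pair (.SKS σ τ ρ) (.lam σ (.var 0)))

/-- `pr₂ ⟨λy:σ. (pr₁ x) y, pr₂ x⟩`, with the free variable `x` of index `0`. -/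
def DTerm.cexEtaCDV (σ : Ty .CDV) : DTerm .CDV :=
  .pr₂ (.pair (.lam σ (.app (.pr₁ (.var 1)) (.var 0))) (.pr₂ (.var 0)))

/-- The type `ω` of `BCD`. -/
def omegaBCD : Ty .BCD := .omega (Or.inr rfl)

/-- `pr₂ ⟨λy:ω. x^(ω → ω) y, x⟩`, with the free variable `x` of index `0`. -/
def DTerm.cexEtaBCD : DTerm .BCD :=
  .pr₂ (.pair (.lam omegaBCD (.app (.coe (.var 1) (.arrow omegaBCD omegaBCD)) (.var 0))) (.var 0))

/-- `λy. x y`, with the free variable `x` of index `0`. -/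
def Term.etaVar : Term := .lam (.app (.var 1) (.var 0))

end DeltaCalculus

open DeltaCalculus

/-! Completeness (`complete`) holds for every theory and every relation: a type assignment
derivation is decorated into a Delta-term, and a strong pair only ever joins terms of equal essence,
so reflexivity of the relation suffices.

Soundness can fail only at the pairing rule, which forgets the essence of the second component. By
`sound_of_invariant` it is enough that typings transfer along the relation. For syntactic equality
this is trivial. For beta-equality with `ω` it is subject reduction, from the generation lemma for
abstractions, plus subject expansion, where intersections collect the types of the several
occurrences of a variable and `ω` serves the variables that do not occur.

Without `ω`, an erased argument must still be typable, so subject expansion breaks: `S K S` is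
beta-equal to the identity, but reduces to `λz. (λy. z) (S z)`, where `S` forces `z` to be a
function. For eta, `λy. x y` is an abstraction and never has an atom other than `ω` as its type,
while `x` may. -/

namespace DeltaCalculus

variable {T : TypeTheory}

/-! Renaming and substitution. -/

theorem Basis.cons_comp_liftRen (B : Basis T) (σ : Ty T) (r : ℕ → ℕ) :
    (fun n => Basis.cons σ B (Term.liftRen r n)) = Basis.cons σ (fun n => B (r n)) := by
  funext n
  cases n <;> rfl

theorem Assigns.rename {C : Basis T} {M : Term} {σ : Ty T} (h : Assigns T C M σ) :
    ∀ {B : Basis T} {r : ℕ → ℕ}, C = (fun n => B (r n)) → Assigns T B (M.rename r) σ := by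
  induction h with
  | ax hn => rintro B r rfl; exact .ax hn
  | arrowI _ ih =>
    rintro B r rfl
    exact .arrowI (ih (Basis.cons_comp_liftRen B _ r).symm)
  | arrowE _ _ ih₁ ih₂ => exact fun hC => .arrowE (ih₁ hC) (ih₂ hC)
  | interI _ _ ih₁ ih₂ => exact fun hC => .interI (ih₁ hC) (ih₂ hC)
  | interE₁ _ ih => exact fun hC => .interE₁ (ih hC)
  | interE₂ _ ih => exact fun hC => .interE₂ (ih hC)
  | top h _ => exact fun _ => .top h _
  | sub _ hle ih => exact fun hC => .sub (ih hC) hle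

theorem Assigns.of_rename {B : Basis T} {N : Term} {σ : Ty T} (h : Assigns T B N σ) :
    ∀ {M : Term} {r : ℕ → ℕ}, N = M.rename r → Assigns T (fun n => B (r n)) M σ := by
  induction h with
  | ax hn =>
    intro M r hM
    cases M <;> cases hM
    exact .ax hn
  | arrowI _ ih =>
    intro M r hM
    cases M <;> cases hM
    exact .arrowI (Basis.cons_comp_liftRen _ _ r ▸ ih rfl)
  | arrowE _ _ ih₁ ih₂ =>
    intro M r hM
    cases M <;> cases hM
    exact .arrowE (ih₁ rfl) (ih₂ rfl)
  | interI _ _ ih₁ ih₂ => exact fun hM => .interI (ih₁ hM) (ih₂ hM)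
  | interE₁ _ ih => exact fun hM => .interE₁ (ih hM)
  | interE₂ _ ih => exact fun hM => .interE₂ (ih hM)
  | top h _ => exact fun _ => .top h _
  | sub _ hle ih => exact fun hM => .sub (ih hM) hle

/-- The types of a variable depend only on its own assumption. -/
theorem Assigns.var_of_eq {B C : Basis T} {n : ℕ} {σ : Ty T} (h : Assigns T C (.var n) σ)
    (hn : C n = B n) : Assigns T B (.var n) σ :=
  -- The constant renaming pulls every basis back to one that knows only the assumption at `n`, and
  -- there the two bases agree.
  (h.of_rename (M := .var n) (r := fun _ => n) rfl).rename (funext fun _ => hn)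

theorem Assigns.weaken {B : Basis T} {M : Term} {σ : Ty T} (τ : Ty T) (h : Assigns T B M σ) :
    Assigns T (B.cons τ) (M.rename Nat.succ) σ :=
  h.rename rfl

theorem Assigns.strengthen {B : Basis T} {M : Term} {σ τ : Ty T}
    (h : Assigns T (B.cons τ) (M.rename Nat.succ) σ) : Assigns T B M σ :=
  h.of_rename rfl

theorem Assigns.subst {C : Basis T} {M : Term} {σ : Ty T} (h : Assigns T C M σ) :
    ∀ {B : Basis T} {s : ℕ → Term}, (∀ n τ, C n = some τ → Assigns T B (s n) τ) →
      Assigns T B (M.subst s) σ := by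
  induction h with
  | ax hn => exact fun hs => hs _ _ hn
  | arrowI _ ih =>
    intro B s hs
    refine .arrowI (ih ?_)
    rintro (_ | n) τ hn
    · exact .ax hn
    · exact (hs n τ hn).weaken _
  | arrowE _ _ ih₁ ih₂ => exact fun hs => .arrowE (ih₁ hs) (ih₂ hs)
  | interI _ _ ih₁ ih₂ => exact fun hs => .interI (ih₁ hs) (ih₂ hs)
  | interE₁ _ ih => exact fun hs => .interE₁ (ih hs)
  | interE₂ _ ih => exact fun hs => .interE₂ (ih hs)
  | top h _ => exact fun _ => .top h _
  | sub _ hle ih => exact fun hs => .sub (ih hs) hle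

theorem Term.liftSubst_var : Term.liftSubst Term.var = Term.var := by
  funext n
  cases n <;> rfl

theorem Term.subst_var (M : Term) : M.subst Term.var = M := by
  induction M with
  | var n => rfl
  | lam M ih => simp only [Term.subst, Term.liftSubst_var, ih]
  | app M N ihM ihN => simp only [Term.subst, ihM, ihN]

/-- This is the substitution lemma for the identity substitution; narrowing and the intersection of
environments are instances. -/
theorem Assigns.change_basis {B C : Basis T} {M : Term} {σ : Ty T} (h : Assigns T C M σ)
    (hBC : ∀ n τ, C n = some τ → Assigns T B (.var n) τ) : Assigns T B M σ :=
  M.subst_var ▸ h.subst hBC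

/-- The narrowing of one assumption of a basis. -/
theorem Assigns.narrow {B : Basis T} {M : Term} {σ σ' τ : Ty T}
    (h : Assigns T (B.cons σ) M τ) (hle : Le T σ' σ) : Assigns T (B.cons σ') M τ := by
  refine h.change_basis ?_
  rintro (_ | n) ρ hn
  · cases hn
    exact .sub (.ax rfl) hle
  · exact .ax hn

/-! Generation lemmas. -/

/-- The types obtained from `ω` and the arrows `σ → τ` with `P σ τ` by intersection. -/
def Ty.Arrows (P : Ty T → Ty T → Prop) : Ty T → Prop
  | .atom (.a _) => False
  | .atom (.omega _) => True
  | .arrow σ τ => P σ τ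
  | .inter σ τ => Ty.Arrows P σ ∧ Ty.Arrows P τ

/-- With typability of the body as the predicate, each subtyping scheme on arrows mirrors a typing
rule: `(ω_→)` is the universal rule, `(→∩)` is intersection introduction, and `(→)` is narrowing
followed by subsumption. So no separate inversion of `≤` between arrows is needed. -/
theorem Le.arrows_assigns {B : Basis T} {M : Term} {σ τ : Ty T} (h : Le T σ τ) :
    σ.Arrows (fun σ τ => Assigns T (B.cons σ) M τ) →
      τ.Arrows (fun σ τ => Assigns T (B.cons σ) M τ) := by
  induction h with
  | refl => exact id
  | incl₁ => exact And.left
  | incl₂ => exact And.right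
  | glb _ _ ih₁ ih₂ => exact fun h => ⟨ih₁ h, ih₂ h⟩
  | trans _ _ ih₁ ih₂ => exact fun h => ih₂ (ih₁ h)
  | omegaTop => exact fun _ => True.intro
  | omegaArrow _ h => exact fun _ => Assigns.top h M
  | arrowInter => exact fun h => Assigns.interI h.1 h.2
  | arrow _ h₁ h₂ => exact fun h => Assigns.sub (Assigns.narrow h h₁) h₂

theorem Assigns.lam_generation {B : Basis T} {M : Term} {σ : Ty T} (h : Assigns T B (.lam M) σ) :
    σ.Arrows (fun σ τ => Assigns T (B.cons σ) M τ) := by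
  generalize hN : Term.lam M = N at h
  induction h with
  | ax | arrowE => cases hN
  | arrowI h => cases hN; exact h
  | interI _ _ ih₁ ih₂ => exact ⟨ih₁ hN, ih₂ hN⟩
  | interE₁ _ ih => exact (ih hN).1
  | interE₂ _ ih => exact (ih hN).2
  | top => exact True.intro
  | sub _ hle ih => exact hle.arrows_assigns (ih hN)

/-! Subject reduction and subject expansion. -/

theorem Assigns.lam_congr {M M' : Term} (hM : ∀ (B : Basis T) σ, Assigns T B M σ → Assigns T B M' σ)
    {B : Basis T} {σ : Ty T} (h : Assigns T B (.lam M) σ) : Assigns T B (.lam M') σ := by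
  generalize hN : Term.lam M = N at h
  induction h with
  | ax | arrowE => cases hN
  | arrowI h => cases hN; exact .arrowI (hM _ _ h)
  | interI _ _ ih₁ ih₂ => exact .interI (ih₁ hN) (ih₂ hN)
  | interE₁ _ ih => exact .interE₁ (ih hN)
  | interE₂ _ ih => exact .interE₂ (ih hN)
  | top h => exact .top h _
  | sub _ hle ih => exact .sub (ih hN) hle

/-- The types of `P` are closed under the intersection, universal and subsumption rules, so only
typings that end with application need checking. This replaces a generation lemma for applications,
and serves both reduction and expansion. -/
theorem Assigns.app_elim {B : Basis T} {M N P : Term} {ρ : Ty T} (h : Assigns T B (.app M N) ρ)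
    (hP : ∀ σ τ, Assigns T B M (.arrow σ τ) → Assigns T B N σ → Assigns T B P τ) :
    Assigns T B P ρ := by
  generalize hQ : Term.app M N = Q at h
  induction h with
  | ax | arrowI => cases hQ
  | arrowE h₁ h₂ => cases hQ; exact hP _ _ h₁ h₂
  | interI _ _ ih₁ ih₂ => exact .interI (ih₁ hP hQ) (ih₂ hP hQ)
  | interE₁ _ ih => exact .interE₁ (ih hP hQ)
  | interE₂ _ ih => exact .interE₂ (ih hP hQ)
  | top h => exact .top h _
  | sub _ hle ih => exact .sub (ih hP hQ) hle

theorem Assigns.inst {B : Basis T} {M N : Term} {σ τ : Ty T} (hM : Assigns T (B.cons σ) M τ)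
    (hN : Assigns T B N σ) : Assigns T B (M.inst N) τ := by
  refine hM.subst ?_
  rintro (_ | n) ρ hn
  · cases hn
    exact hN
  · exact .ax hn

theorem Assigns.subject_reduction {M M' : Term} (hβ : Term.Beta M M') :
    ∀ (B : Basis T) (σ : Ty T), Assigns T B M σ → Assigns T B M' σ := by
  induction hβ with
  | redex M N => exact fun B σ h => h.app_elim fun _ _ h₁ h₂ => Assigns.inst h₁.lam_generation h₂
  | lam _ ih => exact fun B σ h => h.lam_congr ih
  | appL _ _ ih => exact fun B σ h => h.app_elim fun _ _ h₁ h₂ => .arrowE (ih _ _ h₁) h₂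
  | appR _ _ ih => exact fun B σ h => h.app_elim fun _ _ h₁ h₂ => .arrowE h₁ (ih _ _ h₂)

theorem Assigns.inter_env_left {e₁ : ℕ → Ty T} {M : Term} {σ : Ty T}
    (h : Assigns T (fun n => some (e₁ n)) M σ) (e₂ : ℕ → Ty T) :
    Assigns T (fun n => some ((e₁ n).inter (e₂ n))) M σ :=
  h.change_basis fun n τ hn => by cases hn; exact .interE₁ (.ax rfl)

theorem Assigns.inter_env_right {e₂ : ℕ → Ty T} {M : Term} {σ : Ty T}
    (h : Assigns T (fun n => some (e₂ n)) M σ) (e₁ : ℕ → Ty T) :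
    Assigns T (fun n => some ((e₁ n).inter (e₂ n))) M σ :=
  h.change_basis fun n τ hn => by cases hn; exact .interE₂ (.ax rfl)

/-- When `M` is a variable, the substituted term may have any shape, so this case arises for every
syntax-directed rule in the induction on the derivation. -/
theorem Assigns.subst_var_expansion (hω : T.HasOmega) {B : Basis T} {s : ℕ → Term} {N : Term}
    {n : ℕ} {τ : Ty T} (hN : N = s n) (h : Assigns T B N τ) :
    ∃ e : ℕ → Ty T, Assigns T (fun n => some (e n)) (.var n) τ ∧
      ∀ m, Assigns T B (s m) (e m) := by
  subst hN
  -- Every variable other than `n` gets `ω`, which is a type of any term, typable or not.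
  refine ⟨fun m => if m = n then τ else .omega hω, .ax (by simp), fun m => ?_⟩
  by_cases hm : m = n
  · subst hm
    simpa using h
  · simpa [hm] using Assigns.top hω (s m)

/-- A typing of `M[s]` comes from a typing of `M` and typings of the substituted terms. -/
theorem Assigns.subst_expansion (hω : T.HasOmega) {B : Basis T} {N : Term} {τ : Ty T}
    (h : Assigns T B N τ) : ∀ {M : Term} {s : ℕ → Term}, N = M.subst s →
      ∃ e : ℕ → Ty T, Assigns T (fun n => some (e n)) M τ ∧ ∀ n, Assigns T B (s n) (e n) := by
  induction h with
  | ax hn =>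
    intro M s hM
    cases M with
    | var m => exact subst_var_expansion hω hM (.ax hn)
    | lam | app => cases hM
  | @arrowI B N σ τ hN ih =>
    intro M s hM
    cases M with
    | var m => exact subst_var_expansion hω hM (.arrowI hN)
    | app => cases hM
    | lam M =>
      cases hM
      obtain ⟨e, he, hs⟩ := ih rfl
      -- The lifted substitution sends the bound variable to itself, so `e 0` is a type of that
      -- variable under the assumption `σ`, and the assumption `e 0` can be replaced by `σ`.
      refine ⟨fun n => e (n + 1), .arrowI (he.change_basis ?_), fun n => (hs (n + 1)).strengthen⟩
      rintro (_ | n) ρ hn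
      · cases hn
        exact (hs 0).var_of_eq rfl
      · exact .ax hn
  | arrowE h₁ h₂ ih₁ ih₂ =>
    intro M s hM
    cases M with
    | var m => exact subst_var_expansion hω hM (.arrowE h₁ h₂)
    | lam => cases hM
    | app =>
      cases hM
      obtain ⟨e₁, he₁, hs₁⟩ := ih₁ rfl
      obtain ⟨e₂, he₂, hs₂⟩ := ih₂ rfl
      -- A variable may be used at different types in function and argument; the intersection
      -- provides both.
      exact ⟨fun n => (e₁ n).inter (e₂ n),
        .arrowE (he₁.inter_env_left e₂) (he₂.inter_env_right e₁), fun n => .interI (hs₁ n) (hs₂ n)⟩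
  | interI _ _ ih₁ ih₂ =>
    intro M s hM
    obtain ⟨e₁, he₁, hs₁⟩ := ih₁ hM
    obtain ⟨e₂, he₂, hs₂⟩ := ih₂ hM
    exact ⟨fun n => (e₁ n).inter (e₂ n),
      .interI (he₁.inter_env_left e₂) (he₂.inter_env_right e₁), fun n => .interI (hs₁ n) (hs₂ n)⟩
  | interE₁ _ ih =>
    intro M s hM
    obtain ⟨e, he, hs⟩ := ih hM
    exact ⟨e, .interE₁ he, hs⟩
  | interE₂ _ ih =>
    intro M s hM
    obtain ⟨e, he, hs⟩ := ih hM
    exact ⟨e, .interE₂ he, hs⟩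
  | top h => exact fun _ => ⟨fun _ => .omega h, .top h _, fun _ => .top h _⟩
  | sub _ hle ih =>
    intro M s hM
    obtain ⟨e, he, hs⟩ := ih hM
    exact ⟨e, .sub he hle, hs⟩

theorem Assigns.inst_expansion (hω : T.HasOmega) {B : Basis T} {M N : Term} {τ : Ty T}
    (h : Assigns T B (M.inst N) τ) : ∃ σ, Assigns T (B.cons σ) M τ ∧ Assigns T B N σ := by
  obtain ⟨e, he, hs⟩ := h.subst_expansion hω rfl
  refine ⟨e 0, he.change_basis ?_, hs 0⟩
  rintro (_ | n) ρ hn <;> cases hn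
  · exact .ax rfl
  · exact (hs (n + 1)).weaken _

theorem Assigns.subject_expansion (hω : T.HasOmega) {M M' : Term} (hβ : Term.Beta M M') :
    ∀ (B : Basis T) (σ : Ty T), Assigns T B M' σ → Assigns T B M σ := by
  induction hβ with
  | redex M N =>
    intro B τ h
    obtain ⟨σ, hM, hN⟩ := h.inst_expansion hω
    exact .arrowE (.arrowI hM) hN
  | lam _ ih => exact fun B σ h => h.lam_congr ih
  | appL _ _ ih => exact fun B σ h => h.app_elim fun _ _ h₁ h₂ => .arrowE (ih _ _ h₁) h₂
  | appR _ _ ih => exact fun B σ h => h.app_elim fun _ _ h₁ h₂ => .arrowE h₁ (ih _ _ h₂)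

theorem Assigns.betaEq_iff (hω : T.HasOmega) {M N : Term} (h : Term.BetaEq M N) (B : Basis T)
    (σ : Ty T) : Assigns T B M σ ↔ Assigns T B N σ := by
  induction h with
  | rel _ _ h => exact ⟨subject_reduction h B σ, subject_expansion hω h B σ⟩
  | refl => rfl
  | symm _ _ _ ih => exact ih.symm
  | trans _ _ _ _ _ ih₁ ih₂ => exact ih₁.trans ih₂

/-! Soundness and completeness. -/

/-- The essence of a pair is that of its first component, so typings need to move only from the
right side of the relation to the left. -/
theorem sound_of_invariant {R : TermRel}
    (hR : ∀ M N, R.Holds M N → ∀ (B : Basis T) σ, Assigns T B N σ → Assigns T B M σ) :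
    Sound T R := by
  intro B Δ σ h
  induction h with
  | top h _ => exact .top h _
  | ax h => exact .ax h
  | arrowI _ ih => exact .arrowI ih
  | arrowE _ _ ih₁ ih₂ => exact .arrowE ih₁ ih₂
  | interI _ _ h ih₁ ih₂ => exact .interI ih₁ (hR _ _ h _ _ ih₂)
  | interE₁ _ ih => exact .interE₁ ih
  | interE₂ _ ih => exact .interE₂ ih
  | sub _ hle ih => exact .sub ih hle

theorem sound_syn (T : TypeTheory) : Sound T .syn :=
  sound_of_invariant fun _ _ h _ _ => Eq.mpr (by rw [show _ = _ from h])

theorem sound_beta (hω : T.HasOmega) : Sound T .beta :=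
  sound_of_invariant fun _ _ h B σ => (Assigns.betaEq_iff hω h B σ).2

theorem TermRel.Holds.refl (R : TermRel) (M : Term) : R.Holds M M := by
  cases R
  · rfl
  · exact Relation.EqvGen.refl M
  · exact Relation.EqvGen.refl M

theorem complete (T : TypeTheory) (R : TermRel) : Complete T R := by
  intro B M σ h
  induction h with
  | ax h => exact ⟨.var _, rfl, .ax h⟩
  | @arrowI _ _ σ _ _ ih =>
    obtain ⟨Δ, rfl, h⟩ := ih
    exact ⟨.lam σ Δ, rfl, .arrowI h⟩
  | arrowE _ _ ih₁ ih₂ =>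
    obtain ⟨Δ₁, rfl, h₁⟩ := ih₁
    obtain ⟨Δ₂, rfl, h₂⟩ := ih₂
    exact ⟨.app Δ₁ Δ₂, rfl, .arrowE h₁ h₂⟩
  | interI _ _ ih₁ ih₂ =>
    obtain ⟨Δ₁, rfl, h₁⟩ := ih₁
    obtain ⟨Δ₂, h, h₂⟩ := ih₂
    exact ⟨.pair Δ₁ Δ₂, rfl, .interI h₁ h₂ (h ▸ .refl R _)⟩
  | interE₁ _ ih =>
    obtain ⟨Δ, rfl, h⟩ := ih
    exact ⟨.pr₁ Δ, rfl, .interE₁ h⟩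
  | interE₂ _ ih =>
    obtain ⟨Δ, rfl, h⟩ := ih
    exact ⟨.pr₂ Δ, rfl, .interE₂ h⟩
  | @top B h M =>
    -- The index of `u` need not be typable, so any annotation of the abstractions will do.
    have hM : ∃ Δ : DTerm T, M = Δ.essence := by
      induction M with
      | var n => exact ⟨.var n, rfl⟩
      | lam M ih =>
        obtain ⟨Δ, rfl⟩ := ih
        exact ⟨.lam (.omega h) Δ, rfl⟩
      | app M N ihM ihN =>
        obtain ⟨Δ₁, rfl⟩ := ihM
        obtain ⟨Δ₂, rfl⟩ := ihN
        exact ⟨.app Δ₁ Δ₂, rfl⟩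
    obtain ⟨Δ, rfl⟩ := hM
    exact ⟨.u Δ, rfl, .top h Δ⟩
  | @sub _ _ _ τ _ hle ih =>
    obtain ⟨Δ, rfl, h⟩ := ih
    exact ⟨.coe Δ τ, rfl, .sub h hle⟩

/-! Typability in the theories without `ω`. -/

/-- Without the universal rule, every typing of an application contains an application step for it,
so its subterms are typable. -/
theorem Assigns.app_typable (hω : ¬ T.HasOmega) {B : Basis T} {M N : Term} {ρ : Ty T}
    (h : Assigns T B (.app M N) ρ) :
    ∃ σ τ, Assigns T B M (.arrow σ τ) ∧ Assigns T B N σ := by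
  generalize hQ : Term.app M N = Q at h
  induction h with
  | ax | arrowI => cases hQ
  | arrowE h₁ h₂ => cases hQ; exact ⟨_, _, h₁, h₂⟩
  | interI _ _ ih | interE₁ _ ih | interE₂ _ ih | sub _ _ ih => exact ih hQ
  | top h => exact absurd h hω

theorem Assigns.lam_typable (hω : ¬ T.HasOmega) {B : Basis T} {M : Term} {ρ : Ty T}
    (h : Assigns T B (.lam M) ρ) : ∃ σ τ, Assigns T (B.cons σ) M τ := by
  generalize hQ : Term.lam M = Q at h
  induction h with
  | ax | arrowE => cases hQ
  | arrowI h => cases hQ; exact ⟨_, _, h⟩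
  | interI _ _ ih | interE₁ _ ih | interE₂ _ ih | sub _ _ ih => exact ih hQ
  | top h => exact absurd h hω

/-- Intersections of atoms. -/
def Ty.InterAtoms : Ty T → Prop
  | .atom _ => True
  | .arrow _ _ => False
  | .inter σ τ => Ty.InterAtoms σ ∧ Ty.InterAtoms τ

/-- Without `(ω_→)`, every scheme with an arrow on the right has one on the left, so the arrow cases
are vacuous. -/
theorem Le.interAtoms (hω : ¬ T.HasOmega) {σ τ : Ty T} (h : Le T σ τ) :
    σ.InterAtoms → τ.InterAtoms := by
  induction h with
  | refl => exact id
  | incl₁ => exact And.left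
  | incl₂ => exact And.right
  | glb _ _ ih₁ ih₂ => exact fun h => ⟨ih₁ h, ih₂ h⟩
  | trans _ _ ih₁ ih₂ => exact fun h => ih₂ (ih₁ h)
  | omegaTop h | omegaArrow _ h => exact absurd h hω
  | arrowInter => exact And.left
  | arrow => exact id

theorem Assigns.var_interAtoms (hω : ¬ T.HasOmega) {B : Basis T} {n : ℕ} {σ τ : Ty T}
    (hσ : σ.InterAtoms) (hn : B n = some σ) (h : Assigns T B (.var n) τ) : τ.InterAtoms := by
  generalize hQ : Term.var n = Q at h
  induction h with
  | ax h =>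
    cases hQ
    cases hn.symm.trans h
    exact hσ
  | arrowI | arrowE => cases hQ
  | interI _ _ ih₁ ih₂ => exact ⟨ih₁ hn hQ, ih₂ hn hQ⟩
  | interE₁ _ ih => exact (ih hn hQ).1
  | interE₂ _ ih => exact (ih hn hQ).2
  | top h => exact absurd h hω
  | sub _ hle ih => exact hle.interAtoms hω (ih hn hQ)

theorem TypeTheory.not_hasOmega (hT : T = .CD ∨ T = .CDV) : ¬ T.HasOmega := by
  rcases hT with rfl | rfl <;> rintro (h | h) <;> cases h

/-! The counterexamples. -/

/-- `λz. (λy. z) (S z)`, a reduct of `S K S`. -/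
def Term.sksReduct : Term :=
  .lam (.app (.lam (.var 1)) (.app Term.S (.var 0)))

theorem Term.beta_SK :
    Beta (.app Term.S Term.K)
      (.lam (.lam (.app (.app Term.K (.var 0)) (.app (.var 1) (.var 0))))) :=
  .redex _ _

theorem Term.beta_SK_S :
    Beta (.app (.lam (.lam (.app (.app Term.K (.var 0)) (.app (.var 1) (.var 0))))) Term.S)
      (.lam (.app (.app Term.K (.var 0)) (.app Term.S (.var 0)))) :=
  .redex _ _

theorem Term.beta_K_var (N : Term) :
    Beta (.lam (.app (.app Term.K (.var 0)) N)) (.lam (.app (.lam (.var 1)) N)) :=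
  .lam (.appL _ (.redex _ _))

theorem Term.SKS_betaEq : BetaEq (.app (.app Term.S Term.K) Term.S) (.lam (.var 0)) :=
  .trans _ _ _ (.rel _ _ (.appL _ beta_SK)) <| .trans _ _ _ (.rel _ _ beta_SK_S) <|
    .trans _ _ _ (.rel _ _ (beta_K_var _)) (.rel _ _ (.lam (.redex _ _)))

theorem typed_SKS (R : TermRel) (B : Basis T) (σ τ ρ : Ty T) :
    Typed T R B (.SKS σ τ ρ)
      (.arrow (.arrow σ (.arrow τ ρ)) (.arrow σ (.arrow τ ρ))) := by
  refine .arrowE (.arrowE (.arrowI (.arrowI (.arrowI (.arrowE (.arrowE (.ax rfl) (.ax rfl))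
    (.arrowE (.ax rfl) (.ax rfl)))))) (.arrowI (.arrowI (.ax rfl)))) ?_
  exact .arrowI (.arrowI (.arrowI (.arrowE (.arrowE (.ax rfl) (.ax rfl))
    (.arrowE (.ax rfl) (.ax rfl)))))

theorem typed_cexBeta (B : Basis T) (σ τ ρ : Ty T) :
    Typed T .beta B (.cexBeta σ τ ρ) (.arrow σ σ) :=
  .interE₂ (.interI (typed_SKS _ B σ τ ρ) (.arrowI (.ax rfl)) Term.SKS_betaEq)

/-- Reduction stops at `sksReduct`: one further step erases `S z`, the obstruction, and leaves the
identity. -/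
theorem not_assigns_SKS (hω : ¬ T.HasOmega) (B : Basis T) (a : Atom T) :
    ¬ Assigns T B (.app (.app Term.S Term.K) Term.S) (.arrow (.atom a) (.atom a)) := by
  intro h
  have h₁ : Assigns T B Term.sksReduct (.arrow (.atom a) (.atom a)) :=
    Assigns.subject_reduction (Term.beta_K_var _) _ _ <|
      Assigns.subject_reduction Term.beta_SK_S _ _ <|
        Assigns.subject_reduction (.appL _ Term.beta_SK) _ _ h
  obtain ⟨_, _, _, hSz⟩ := Assigns.app_typable hω h₁.lam_generation
  obtain ⟨σ, _, hS, hz⟩ := hSz.app_typable hω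
  -- The variable `z` has an atom as its assumption, so the domain at which `S` is used is an
  -- intersection of atoms; yet the body of `S` applies its first argument, which therefore needs an
  -- arrow type.
  have hσ : σ.InterAtoms := hz.var_interAtoms hω (σ := .atom a) trivial rfl
  obtain ⟨_, _, hy⟩ := Assigns.lam_typable hω hS.lam_generation
  obtain ⟨_, _, hxzyz⟩ := hy.lam_typable hω
  obtain ⟨_, _, hxz, _⟩ := hxzyz.app_typable hω
  obtain ⟨_, _, hx, _⟩ := hxz.app_typable hω
  exact hx.var_interAtoms hω hσ rfl

theorem Term.etaVar_betaEtaEq : BetaEtaEq Term.etaVar (.var 0) :=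
  .rel _ _ (.inr (.redex (.var 0)))

theorem typed_cexEtaCDV (σ τ ρ : Ty .CDV) (B : Basis .CDV) :
    Typed .CDV .betaEta (B.cons (.inter (.arrow σ τ) ρ)) (.cexEtaCDV σ) ρ :=
  .interE₂ (.interI (.arrowI (.arrowE (.interE₁ (.ax rfl)) (.ax rfl))) (.interE₂ (.ax rfl))
    Term.etaVar_betaEtaEq)

/-- Since `σ ≤ ω ≤ ω → ω`, any variable can be coerced to a function, so its eta-expansion is always
typable. -/
theorem typed_cexEtaBCD (σ : Ty .BCD) (B : Basis .BCD) :
    Typed .BCD .betaEta (B.cons σ) .cexEtaBCD σ :=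
  .interE₂ (.interI
    (.arrowI (.arrowE
      (.sub (.ax rfl) (.trans (.omegaTop (Or.inr rfl) σ) (.omegaArrow rfl (Or.inr rfl) omegaBCD)))
      (.ax rfl)))
    (.ax rfl) Term.etaVar_betaEtaEq)

/-- The generation lemma at the atom `aᵢ` unfolds to `False`. -/
theorem not_assigns_lam_a (B : Basis T) (M : Term) (i : ℕ) :
    ¬ Assigns T B (.lam M) (.atom (.a i)) :=
  fun h => h.lam_generation

theorem not_assigns_lam_atom (hω : ¬ T.HasOmega) (B : Basis T) (M : Term) (a : Atom T) :
    ¬ Assigns T B (.lam M) (.atom a) := by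
  cases a with
  | a i => exact not_assigns_lam_a B M i
  | omega h => exact absurd h hω

theorem not_sound_beta (hω : ¬ T.HasOmega) : ¬ Sound T .beta := fun h =>
  not_assigns_SKS hω Basis.empty (.a 0)
    (h _ _ _ (typed_cexBeta Basis.empty (.atom (.a 0)) (.atom (.a 0)) (.atom (.a 0))))

theorem not_sound_CDV_betaEta : ¬ Sound .CDV .betaEta := fun h =>
  not_assigns_lam_a _ _ 0
    (h _ _ _ (typed_cexEtaCDV (.atom (.a 0)) (.atom (.a 0)) (.atom (.a 0)) Basis.empty))

theorem not_sound_BCD_betaEta : ¬ Sound .BCD .betaEta := fun h =>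
  not_assigns_lam_a _ _ 0 (h _ _ _ (typed_cexEtaBCD (.atom (.a 0)) Basis.empty))

end DeltaCalculus

theorem mainTheorem4 :
    -- the six systems for which soundness and completeness both hold
    (Isomorphic .CD .syn ∧ Isomorphic .CDV .syn ∧ Isomorphic .CDS .syn ∧ Isomorphic .BCD .syn ∧
      Isomorphic .CDS .beta ∧ Isomorphic .BCD .beta) ∧
    -- the four systems that are complete but not sound
    ((Complete .CD .beta ∧ ¬ Sound .CD .beta) ∧
      (Complete .CDV .beta ∧ ¬ Sound .CDV .beta) ∧
      (Complete .CDV .betaEta ∧ ¬ Sound .CDV .betaEta) ∧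
      (Complete .BCD .betaEta ∧ ¬ Sound .BCD .betaEta)) ∧
    -- the counterexamples to soundness for CD and CDV with beta-equality
    (∀ T : TypeTheory, T = .CD ∨ T = .CDV → ∀ σ τ ρ : Ty T,
      Typed T .beta Basis.empty (DTerm.cexBeta σ τ ρ) (.arrow σ σ) ∧
      (DTerm.cexBeta σ τ ρ).essence = .app (.app Term.S Term.K) Term.S ∧
      ((∃ a : Atom T, σ = .atom a) →
        ¬ Assigns T Basis.empty (.app (.app Term.S Term.K) Term.S) (.arrow σ σ))) ∧
    -- the counterexample for CDV with beta-eta-equality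
    (∀ σ τ ρ : Ty .CDV,
      Typed .CDV .betaEta (Basis.cons (.inter (.arrow σ τ) ρ) Basis.empty)
        (DTerm.cexEtaCDV σ) ρ ∧
      (DTerm.cexEtaCDV σ).essence = Term.etaVar ∧
      ((∃ a : Atom .CDV, ρ = .atom a) →
        ¬ Assigns .CDV (Basis.cons (.inter (.arrow σ τ) ρ) Basis.empty) Term.etaVar ρ)) ∧
    -- the counterexample for BCD with beta-eta-equality
    (∀ σ : Ty .BCD,
      Typed .BCD .betaEta (Basis.cons σ Basis.empty) DTerm.cexEtaBCD σ ∧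
      DTerm.cexEtaBCD.essence = Term.etaVar ∧
      ((∃ i : ℕ, σ = .atom (.a i)) →
        ¬ Assigns .BCD (Basis.cons σ Basis.empty) Term.etaVar σ)) := by
  have hCD : ¬ TypeTheory.CD.HasOmega := TypeTheory.not_hasOmega (.inl rfl)
  have hCDV : ¬ TypeTheory.CDV.HasOmega := TypeTheory.not_hasOmega (.inr rfl)
  refine ⟨⟨⟨complete _ _, sound_syn _⟩, ⟨complete _ _, sound_syn _⟩, ⟨complete _ _, sound_syn _⟩,
    ⟨complete _ _, sound_syn _⟩, ⟨complete _ _, sound_beta (.inl rfl)⟩,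
    ⟨complete _ _, sound_beta (.inr rfl)⟩⟩,
    ⟨⟨complete _ _, not_sound_beta hCD⟩, ⟨complete _ _, not_sound_beta hCDV⟩,
      ⟨complete _ _, not_sound_CDV_betaEta⟩, ⟨complete _ _, not_sound_BCD_betaEta⟩⟩, ?_, ?_, ?_⟩
  · intro T hT σ τ ρ
    refine ⟨typed_cexBeta _ σ τ ρ, rfl, ?_⟩
    rintro ⟨a, rfl⟩
    exact not_assigns_SKS (TypeTheory.not_hasOmega hT) _ a
  · intro σ τ ρ
    refine ⟨typed_cexEtaCDV σ τ ρ _, rfl, ?_⟩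
    rintro ⟨a, rfl⟩
    exact not_assigns_lam_atom hCDV _ _ a
  · intro σ
    refine ⟨typed_cexEtaBCD σ _, rfl, ?_⟩
    rintro ⟨i, rfl⟩
    exact not_assigns_lam_a _ _ i
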